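/- Let $K$ be a field, $m\ge 1$ and $x=(x_1,\ldots,x_m)$. Write $K\langle x\rangle$ for the ring of algebraic power series, that is, the subring of $K[[x]]$ consisting of the formal power series that are algebraic over the polynomial ring $K[x]$; similarly $K\langle x_1,\ldots,x_{m-1}\rangle\subset K[[x_1,\ldots,x_{m-1}]]$ (both equal to $K$ when $m=1$). Call a polynomial over $K[[x_1,\ldots,x_{m-1}]]$ in the variable $x_m$ a Weierstrass polynomial if it has the form $x_m^p+\sum_{i=0}^{p-1}z_i x_m^i$ for some $p\in\mathbb N$ (possibly $p=0$), where each $z_i$ has zero constant term. **Corollary (Weierstrass Preparation Theorem for algebraic power series).** Let $f\in K\langle x\rangle$ satisfy $f(0,\ldots,0,x_m)\neq 0$. Then there exist a unit $y$ of the ring $K\langle x\rangle$ and a Weierstrass polynomial $g\in K\langle x_1,\ldots,x_{m-1}\rangle[x_m]$ such that $f=y\,g$. Moreover, this factorization is the only one even among formal power series: if $f=\hat y\,\hat g$ with $\hat y$ a unit of $K[[x]]$ and $\hat g\in K[[x_1,\ldots,x_{m-1}]][x_m]$ a Weierstrass polynomial, then $\hat y=y$ and $\hat g=g$. -/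

import Mathlib

noncomputable section

/-- The ring `K⟨x⟩` of algebraic power series in the variables `x_i`, `i : σ`, over a field `K`:
the algebraic closure of the polynomial ring `K[x]` in the formal power series ring `K[[x]]`,
i.e. the power series that are algebraic over `K[x]`. -/
abbrev AlgPowerSeries (σ : Type*) (K : Type*) [Field K] :
    Subalgebra (MvPolynomial σ K) (MvPowerSeries σ K) :=
  Subalgebra.algebraicClosure (MvPolynomial σ K) (MvPowerSeries σ K)

/-- The restriction `f(0,…,0,x_m)` of a power series `f` in `m = n + 1` variables to the axis of
the last variable: all variables but the last one are set to `0`. -/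
def restrictLast {K : Type*} [Field K] {n : ℕ} (f : MvPowerSeries (Fin (n + 1)) K) :
    PowerSeries K :=
  MvPowerSeries.killCompl (⟨fun _ => Fin.last n, fun _ _ _ => rfl⟩ : Unit ↪ Fin (n + 1)) f

/-- A polynomial in `K[[x_1,…,x_n]][T]`, read as a power series in `x_1,…,x_n,x_{n+1}` by
putting `T = x_{n+1}`. -/
def polyToPowerSeries {K : Type*} [Field K] {n : ℕ} :
    Polynomial (MvPowerSeries (Fin n) K) →+* MvPowerSeries (Fin (n + 1)) K :=
  Polynomial.eval₂RingHom
    ((MvPowerSeries.rename (R := K) (Fin.castSucc : Fin n → Fin (n + 1))) :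
      MvPowerSeries (Fin n) K →+* MvPowerSeries (Fin (n + 1)) K)
    (MvPowerSeries.X (Fin.last n))

/-- The inclusion `K⟨x_1,…,x_n⟩[T] ⊆ K[[x_1,…,x_n]][T]`. -/
def algPolyToPoly {K : Type*} [Field K] {n : ℕ} :
    Polynomial (AlgPowerSeries (Fin n) K) →+* Polynomial (MvPowerSeries (Fin n) K) :=
  Polynomial.mapRingHom (AlgPowerSeries (Fin n) K).subtype

/-- A Weierstrass polynomial over `K[[x_1,…,x_n]]`: a monic polynomial
`T^p + z_{p-1} T^{p-1} + ⋯ + z_0` (with `p = 0` allowed) such that every `z_i` lies in the ideal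
of the power series without constant term. -/
def IsWeierstrassPoly {K : Type*} [Field K] {n : ℕ}
    (g : Polynomial (MvPowerSeries (Fin n) K)) : Prop :=
  g.IsDistinguishedAt
    (RingHom.ker (MvPowerSeries.constantCoeff : MvPowerSeries (Fin n) K →+* K))

end

open scoped Polynomial nonZeroDivisors

/-! Write `A` for the power series ring in all variables but the last, a complete local ring, and
read `f` in `A[[T]]`. Formal Weierstrass preparation over `A` gives `f = y g` and its uniqueness;
what remains is algebraicity. An algebraic `f ≠ 0` divides a nonzero polynomial `P`, hence so does
`g`, at first in `A[[T]]`. Uniqueness of Weierstrass division moves this divisibility to `A[T]`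
(`dvd_of_coe_dvd`). The roots of the monic `g` are then roots of `P`, so its coefficients are
algebraic over the polynomials in the first variables (`isAlgebraic_coeff_of_dvd_map`). Finally `y =
f / g` and `y⁻¹` are algebraic too. -/

namespace MvPowerSeries

/-! ### Completeness of the formal power series ring -/

/-- A power series in finitely many variables without constant term lies in the ideal
generated by the variables. -/
theorem ker_constantCoeff_eq_span_range_X {σ R : Type*} [Finite σ] [CommRing R] :
    RingHom.ker (constantCoeff : MvPowerSeries σ R →+* R) = Ideal.span (Set.range X) := by
  apply le_antisymm
  · intro φ hφ
    rw [RingHom.mem_ker] at hφ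
    let I := MvPolynomial.idealOfVars σ R
    let e := (toAdicCompletionAlgEquiv σ R)
    have h1 : e φ ∈ RingHom.ker (AdicCompletion.evalOneₐ I).toRingHom := by
      have : (truncTotal 1 φ) = 0 := by
        ext x
        by_cases hx : x.degree < 1
        · rw [coeff_truncTotal _ hx]
          rw [(Finsupp.degree_eq_zero_iff x).1 (Nat.lt_one_iff.1 hx)]
          simpa using hφ
        · rw [coeff_truncTotal_eq_zero _ (not_lt.1 hx)]; simp
      rw [RingHom.mem_ker]
      change AdicCompletion.evalOneₐ I (toAdicCompletion σ R φ) = 0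
      rw [← AdicCompletion.factorₐ_evalₐ_one, ← AdicCompletion.factor_eval_eq_evalₐ I _ (by simp),
        AdicCompletion.eval_apply, toAdicCompletion_apply_eq_mk_truncTotal, this]
      simp
    -- Finitely many variables make `I` finitely generated, so the kernel of reduction modulo `I` is
    -- the extension of `I` to the completion.
    rw [AdicCompletion.ker_evalOneₐ_eq_map I (MvPolynomial.idealOfVars_fg σ R)] at h1
    have h2 : (I.map (algebraMap _ (AdicCompletion I (MvPolynomial σ R)))).map e.symm.toRingEquiv
        = Ideal.span (Set.range X) := by
      simp only [I, MvPolynomial.idealOfVars, Ideal.map_span, ← Set.range_comp]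
      congr 2; ext1 i
      simp only [Function.comp]
      exact (e.symm.commutes _).trans (by simp [MvPowerSeries.algebraMap_apply'])
    rw [← h2]
    have := Ideal.mem_map_of_mem e.symm.toRingEquiv h1
    simpa using this
  · rw [Ideal.span_le]
    rintro _ ⟨i, rfl⟩
    simp [RingHom.mem_ker]

theorem maximalIdeal_eq_ker_constantCoeff {σ K : Type*} [Field K] :
    IsLocalRing.maximalIdeal (MvPowerSeries σ K) =
      RingHom.ker (constantCoeff : MvPowerSeries σ K →+* K) := by
  ext φ
  rw [IsLocalRing.mem_maximalIdeal, mem_nonunits_iff, isUnit_iff_constantCoeff, RingHom.mem_ker,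
    isUnit_iff_ne_zero, not_not]

instance isAdicComplete_maximalIdeal {σ K : Type*} [Finite σ] [Field K] :
    IsAdicComplete (IsLocalRing.maximalIdeal (MvPowerSeries σ K)) (MvPowerSeries σ K) := by
  rw [maximalIdeal_eq_ker_constantCoeff, ker_constantCoeff_eq_span_range_X]
  infer_instance

/-! ### Splitting off the last variable -/

/-- Power series in `n + 1` variables as power series in the last variable. -/
noncomputable def finSuccEquivLast (R : Type*) [CommSemiring R] (n : ℕ) :
    MvPowerSeries (Fin (n + 1)) R ≃ₐ[R] PowerSeries (MvPowerSeries (Fin n) R) :=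
  (renameEquiv R _root_.finSuccEquivLast).trans (optionEquivLeft (Fin n) R)

@[simp]
theorem finSuccEquivLast_X_last {R : Type*} [CommSemiring R] {n : ℕ} :
    finSuccEquivLast R n (X (Fin.last n)) = PowerSeries.X := by
  simp [finSuccEquivLast]

@[simp]
theorem finSuccEquivLast_X_castSucc {R : Type*} [CommSemiring R] {n : ℕ} (i : Fin n) :
    finSuccEquivLast R n (X i.castSucc) = PowerSeries.C (X i) := by
  simp [finSuccEquivLast]

@[simp]
theorem finSuccEquivLast_C {R : Type*} [CommSemiring R] {n : ℕ} (r : R) :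
    finSuccEquivLast R n (C r) = PowerSeries.C (C r) := by
  simp [finSuccEquivLast]

theorem optionEquivLeft_rename_some {σ R : Type*} [CommSemiring R] (a : MvPowerSeries σ R) :
    optionEquivLeft σ R (rename (Function.Embedding.some : σ ↪ Option σ) a) = PowerSeries.C a := by
  ext k x
  rw [coeff_coeff_optionEquivLeft, PowerSeries.coeff_C]
  split_ifs with hk
  · have : x.optionElim k = Finsupp.embDomain Function.Embedding.some x := by
      ext (_ | i)
      · rw [Finsupp.embDomain_some_none, Finsupp.optionElim_apply_none, hk]
      · exact (Finsupp.optionElim_apply_some k x i).trans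
          (Finsupp.embDomain_apply_self Function.Embedding.some x i).symm
    rw [this, coeff_embDomain_rename]
  · rw [coeff_rename_eq_zero, coeff_zero]
    rintro ⟨y, hy⟩
    have := DFunLike.congr_fun hy none
    rw [Finsupp.mapDomain_of_notMem_range _ _ (by simp)] at this
    exact hk (by simpa using this.symm)

@[simp]
theorem finSuccEquivLast_rename_castSucc {R : Type*} [CommSemiring R] {n : ℕ}
    (a : MvPowerSeries (Fin n) R) :
    finSuccEquivLast R n (rename Fin.castSucc a) = PowerSeries.C a := by
  have h : (_root_.finSuccEquivLast ∘ Fin.castSucc : Fin n → Option (Fin n)) =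
      Function.Embedding.some := by
    ext1 i
    simp
  rw [← optionEquivLeft_rename_some, finSuccEquivLast, AlgEquiv.trans_apply]
  change optionEquivLeft _ R (rename _ _) = _
  rw [rename_rename]
  simp only [h]

end MvPowerSeries

open MvPowerSeries

theorem finSuccEquivLast_polyToPowerSeries {K : Type*} [Field K] {n : ℕ}
    (g : (MvPowerSeries (Fin n) K)[X]) :
    MvPowerSeries.finSuccEquivLast K n (polyToPowerSeries g) = (g : PowerSeries _) := by
  have : ((MvPowerSeries.finSuccEquivLast K n).toRingEquiv.toRingHom.comp polyToPowerSeries) =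
      Polynomial.coeToPowerSeries.ringHom := by
    apply Polynomial.ringHom_ext <;> simp [polyToPowerSeries]
  exact DFunLike.congr_fun this g

/-- On polynomials, `MvPowerSeries.finSuccEquivLast` is the polynomial version. -/
theorem finSuccEquivLast_coe {K : Type*} [Field K] {n : ℕ}
    (P : MvPolynomial (Fin (n + 1)) K) :
    MvPowerSeries.finSuccEquivLast K n (P : MvPowerSeries (Fin (n + 1)) K) =
      (((MvPolynomial.optionEquivLeft K (Fin n)
        (MvPolynomial.renameEquiv K finSuccEquivLast P)).map
          (algebraMap _ (MvPowerSeries (Fin n) K)) : (MvPowerSeries (Fin n) K)[X]) :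
            PowerSeries _) := by
  induction P using MvPolynomial.induction_on with
  | C a => simp [MvPowerSeries.algebraMap_apply']
  | add p q hp hq =>
    simp only [MvPolynomial.coe_add, map_add, hp, hq, Polynomial.map_add, Polynomial.coe_add]
  | mul_X p i hp =>
    simp only [MvPolynomial.coe_mul, map_mul, hp, Polynomial.map_mul, Polynomial.coe_mul]
    congr 1
    induction i using Fin.lastCases <;> simp [MvPowerSeries.algebraMap_apply']

/-- The residue of the `k`-th coefficient is its constant term, which is the `k`-th coefficient of
the restriction to the last axis. This supplies the hypothesis of formal preparation. -/
theorem map_residue_finSuccEquivLast_ne_zero {K : Type*} [Field K] {n : ℕ}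
    {f : MvPowerSeries (Fin (n + 1)) K} (hf : restrictLast f ≠ 0) :
    (MvPowerSeries.finSuccEquivLast K n f).map
      (IsLocalRing.residue (MvPowerSeries (Fin n) K)) ≠ 0 := by
  contrapose! hf
  ext k
  have h := congrArg (PowerSeries.coeff k) hf
  rw [PowerSeries.coeff_map, map_zero, IsLocalRing.residue_eq_zero_iff,
    maximalIdeal_eq_ker_constantCoeff, RingHom.mem_ker, ← coeff_zero_eq_constantCoeff_apply,
    MvPowerSeries.finSuccEquivLast, AlgEquiv.trans_apply, coeff_coeff_optionEquivLeft] at h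
  rw [map_zero, ← h, restrictLast, PowerSeries.coeff, coeff_killCompl,
    ← coeff_embDomain_rename (_root_.finSuccEquivLast (n := n)).toEmbedding]
  simp only [Finsupp.embDomain_single]
  congr 2
  have : (_root_.finSuccEquivLast (n := n)).toEmbedding
      ((⟨fun _ => Fin.last n, fun _ _ _ => rfl⟩ : Unit ↪ Fin (n + 1)) ()) = none :=
    finSuccEquivLast_last
  rw [this]
  ext (_ | i) <;> simp

/-! ### Divisibility by monic polynomials -/

/-- A distinguished polynomial dividing a polynomial as a power series divides it as a
polynomial. -/
theorem Polynomial.IsDistinguishedAt.dvd_of_coe_dvd {A : Type*} [CommRing A] {I : Ideal A}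
    [IsHausdorff I A] (hI : I ≠ ⊤) {g P : A[X]} (hg : g.IsDistinguishedAt I)
    (h : (g : PowerSeries A) ∣ P) : g ∣ P := by
  have := Ideal.Quotient.nontrivial_iff.mpr hI
  have : Nontrivial A := (Ideal.Quotient.mk I).domain_nontrivial
  obtain ⟨q, hq⟩ := h
  -- Weierstrass division bounds remainders by the order of `g` modulo `I`; for a distinguished `g`
  -- this order is its degree.
  have hdeg : g.natDegree = _ := congr(ENat.toNat $(hg.coe_natDegree_eq_order_map g 1
    (by rwa [PowerSeries.constantCoeff_one, ← Ideal.ne_top_iff_one]) (by simp)))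
  have hmod := Polynomial.modByMonic_add_div P g
  have key : (g : PowerSeries A) * (q - (P /ₘ g : A[X])) = (P %ₘ g : A[X]) := by
    rw [mul_sub, ← hq, ← Polynomial.coe_mul, ← Polynomial.coe_sub, sub_eq_of_eq_add hmod.symm]
  -- A multiple of `g` that is a polynomial of degree less than that of `g` vanishes, so the
  -- Euclidean remainder is zero.
  have := hg.isWeierstrassDivisorAt'.eq_zero_of_mul_eq (by
    rw [← hdeg, ← Polynomial.degree_eq_natDegree hg.monic.ne_zero]
    exact Polynomial.degree_modByMonic_lt _ hg.monic) key
  exact (Polynomial.modByMonic_eq_zero_iff_dvd hg.monic).mp this.2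

/-- The coefficients of a monic polynomial dividing a nonzero polynomial over a subring are
algebraic over that subring. -/
theorem Polynomial.Monic.isAlgebraic_coeff_of_dvd_map {R A : Type*} [CommRing R] [IsDomain R]
    [CommRing A] [IsDomain A] [Algebra R A] [FaithfulSMul R A] {g : A[X]} (hg : g.Monic)
    {P : R[X]} (hP : P ≠ 0) (h : g ∣ P.map (algebraMap R A)) (i : ℕ) :
    IsAlgebraic R (g.coeff i) := by
  classical
  let F := FractionRing R
  let L := FractionRing A
  let _ : Algebra F L := FractionRing.liftAlgebra R L
  have : IsScalarTower R F L := FractionRing.isScalarTower_liftAlgebra R L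
  let Q : F[X] := P.map (algebraMap R F)
  have hQ : Q ≠ 0 := (Polynomial.map_ne_zero_iff (IsFractionRing.injective R F)).2 hP
  have hd : g.map (algebraMap A L) ∣ (normalize Q).map (algebraMap F L) := by
    have h1 : g.map (algebraMap A L) ∣ Q.map (algebraMap F L) := by
      have := Polynomial.map_dvd (algebraMap A L) h
      rwa [Polynomial.map_map, ← IsScalarTower.algebraMap_eq, IsScalarTower.algebraMap_eq R F L,
        ← Polynomial.map_map] at this
    exact h1.trans (Polynomial.map_dvd _ (associated_normalize Q).dvd)
  -- Monic factors of a monic polynomial over `F` have coefficients integral over `F`; this is why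
  -- `Q` was normalized.
  have hl := integralClosure.mem_lifts_of_monic_of_dvd_map L (Polynomial.monic_normalize hQ)
    (hg.map _) hd
  rw [Polynomial.lifts_iff_coeff_lifts] at hl
  obtain ⟨c, hc⟩ := hl i
  have hci : IsIntegral F (algebraMap A L (g.coeff i)) := by
    rw [← Polynomial.coeff_map, ← hc]
    exact c.2
  have := (IsFractionRing.isAlgebraic_iff R F L).2 hci.isAlgebraic
  exact (isAlgebraic_algebraMap_iff (IsFractionRing.injective A L)).1 this

/-! ### Algebraicity of the factors -/

theorem isWeierstrassFactorization_finSuccEquivLast {K : Type*} [Field K] {n : ℕ}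
    {f y : MvPowerSeries (Fin (n + 1)) K} {g : (MvPowerSeries (Fin n) K)[X]} (hy : IsUnit y)
    (hg : IsWeierstrassPoly g) (h : f = y * polyToPowerSeries g) :
    (MvPowerSeries.finSuccEquivLast K n f).IsWeierstrassFactorization g
      (MvPowerSeries.finSuccEquivLast K n y) where
  isDistinguishedAt := by rwa [maximalIdeal_eq_ker_constantCoeff]
  isUnit := hy.map _
  eq_mul := by rw [h, map_mul, finSuccEquivLast_polyToPowerSeries, mul_comm]

/-- The coefficients of the Weierstrass polynomial of an algebraic power series are algebraic. -/
theorem IsWeierstrassPoly.isAlgebraic_coeff {K : Type*} [Field K] {n : ℕ}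
    {f y : MvPowerSeries (Fin (n + 1)) K} {g : (MvPowerSeries (Fin n) K)[X]}
    (hf : IsAlgebraic (MvPolynomial (Fin (n + 1)) K) f) (hf0 : f ≠ 0)
    (hg : IsWeierstrassPoly g) (h : f = y * polyToPowerSeries g) (i : ℕ) :
    IsAlgebraic (MvPolynomial (Fin n) K) (g.coeff i) := by
  obtain ⟨P, hP, hdvd⟩ := hf.exists_nonzero_dvd (mem_nonZeroDivisors_of_ne_zero hf0)
  have hgP : polyToPowerSeries g ∣ (P : MvPowerSeries (Fin (n + 1)) K) :=
    (Dvd.intro_left y h.symm).trans hdvd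
  have : IsDomain (MvPowerSeries (Fin n) K) := NoZeroDivisors.to_isDomain _
  have : FaithfulSMul (MvPolynomial (Fin n) K) (MvPowerSeries (Fin n) K) := by
    rw [faithfulSMul_iff_algebraMap_injective]
    intro p q hpq
    simpa [MvPowerSeries.algebraMap_apply'] using hpq
  have := map_dvd (MvPowerSeries.finSuccEquivLast K n) hgP
  rw [finSuccEquivLast_polyToPowerSeries, finSuccEquivLast_coe] at this
  have hg' := hg
  rw [IsWeierstrassPoly, ← maximalIdeal_eq_ker_constantCoeff] at hg'
  refine hg'.monic.isAlgebraic_coeff_of_dvd_map ?_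
    (hg'.dvd_of_coe_dvd (Ideal.IsMaximal.ne_top inferInstance) this) i
  exact (map_ne_zero_iff _ (AlgEquiv.injective _)).2
    ((map_ne_zero_iff _ (AlgEquiv.injective _)).2 hP)

theorem isAlgebraic_rename_castSucc {K : Type*} [Field K] {n : ℕ} {a : MvPowerSeries (Fin n) K}
    (ha : IsAlgebraic (MvPolynomial (Fin n) K) a) :
    IsAlgebraic (MvPolynomial (Fin (n + 1)) K) (rename Fin.castSucc a) := by
  refine ha.ringHom_of_comp_eq (MvPolynomial.rename (R := K) (Fin.castSucc (n := n))).toRingHom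
    (rename Fin.castSucc : MvPowerSeries (Fin n) K →ₐ[K] _).toRingHom
    (MvPolynomial.rename_injective _ (Fin.castSucc_injective n)) ?_
  ext p <;> simp [MvPowerSeries.algebraMap_apply']

theorem polyToPowerSeries_mem_algPowerSeries {K : Type*} [Field K] {n : ℕ}
    (g : (AlgPowerSeries (Fin n) K)[X]) :
    polyToPowerSeries (algPolyToPoly g) ∈ AlgPowerSeries (Fin (n + 1)) K := by
  rw [polyToPowerSeries, Polynomial.coe_eval₂RingHom, Polynomial.eval₂_eq_sum_range]
  refine sum_mem fun i _ => mul_mem ?_ (pow_mem ?_ _)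
  · refine isAlgebraic_rename_castSucc ?_
    simp only [algPolyToPoly, Polynomial.coe_mapRingHom, Polynomial.coeff_map]
    exact (g.coeff i).2
  · have := isAlgebraic_algebraMap (R := MvPolynomial (Fin (n + 1)) K)
      (A := MvPowerSeries (Fin (n + 1)) K) (MvPolynomial.X (Fin.last n))
    rw [Subalgebra.mem_algebraicClosure]
    simpa [MvPowerSeries.algebraMap_apply'] using this

theorem mainTheorem7 {K : Type*} [Field K] {n : ℕ}
    (f : AlgPowerSeries (Fin (n + 1)) K)
    (hf : restrictLast (f : MvPowerSeries (Fin (n + 1)) K) ≠ 0) :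
    ∃ (y : AlgPowerSeries (Fin (n + 1)) K) (g : Polynomial (AlgPowerSeries (Fin n) K)),
      IsUnit y ∧
      IsWeierstrassPoly (algPolyToPoly g) ∧
      (f : MvPowerSeries (Fin (n + 1)) K) = y * polyToPowerSeries (algPolyToPoly g) ∧
      ∀ (y' : MvPowerSeries (Fin (n + 1)) K) (g' : Polynomial (MvPowerSeries (Fin n) K)),
        IsUnit y' → IsWeierstrassPoly g' →
        (f : MvPowerSeries (Fin (n + 1)) K) = y' * polyToPowerSeries g' →
        y' = y ∧ g' = algPolyToPoly g := by
  obtain ⟨f, hfa⟩ := f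
  simp only at hf ⊢
  have hf0 : f ≠ 0 := by
    rintro rfl
    exact hf (map_zero _)
  obtain ⟨g, h, H⟩ :=
    PowerSeries.exists_isWeierstrassFactorization (map_residue_finSuccEquivLast_ne_zero hf)
  obtain ⟨y, rfl⟩ := (MvPowerSeries.finSuccEquivLast K n).surjective h
  have hg : IsWeierstrassPoly g := by
    rw [IsWeierstrassPoly, ← maximalIdeal_eq_ker_constantCoeff]
    exact H.isDistinguishedAt
  have hy : IsUnit y := by simpa using H.isUnit
  have hfyg : f = y * polyToPowerSeries g := by
    apply (MvPowerSeries.finSuccEquivLast K n).injective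
    rw [H.eq_mul, map_mul, finSuccEquivLast_polyToPowerSeries, mul_comm]
  obtain ⟨g, rfl⟩ : ∃ g₀ : (AlgPowerSeries (Fin n) K)[X], algPolyToPoly g₀ = g := by
    have : g ∈ Polynomial.lifts (AlgPowerSeries (Fin n) K).subtype := by
      rw [Polynomial.lifts_iff_coeff_lifts]
      exact fun i => ⟨⟨g.coeff i, hg.isAlgebraic_coeff hfa hf0 hfyg i⟩, rfl⟩
    exact (Polynomial.mem_lifts g).1 this
  have hya : IsAlgebraic (MvPolynomial (Fin (n + 1)) K) y := by
    refine (polyToPowerSeries_mem_algPowerSeries g).of_mul (mem_nonZeroDivisors_of_ne_zero ?_) ?_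
    · rintro h0
      exact hf0 (by rw [hfyg, h0, mul_zero])
    · rwa [mul_comm, ← hfyg]
  -- Being a unit in the subring requires the formal inverse to be algebraic as well.
  have hyu : IsUnit (⟨y, hya⟩ : AlgPowerSeries (Fin (n + 1)) K) := by
    obtain ⟨z, hz⟩ := hy.exists_right_inv
    have hza : IsAlgebraic (MvPolynomial (Fin (n + 1)) K) z :=
      hya.of_mul hy.mem_nonZeroDivisors (hz ▸ isAlgebraic_one)
    exact IsUnit.of_mul_eq_one ⟨z, hza⟩ (Subtype.ext hz)
  refine ⟨⟨y, hya⟩, g, hyu, hg, hfyg, fun y' g' hy' hg' h' => ?_⟩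
  -- Any competing factorization is a Weierstrass factorization in `A[[T]]`, where uniqueness holds
  -- formally.
  obtain ⟨h1, h2⟩ := (isWeierstrassFactorization_finSuccEquivLast hy' hg' h').elim H
  exact ⟨(MvPowerSeries.finSuccEquivLast K n).injective h2, h1⟩
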